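/- A binary linear $[n,k,d]$ code is a $k$-dimensional subspace $C\subseteq\mathbb F_2^n$ with minimum Hamming distance $d$; it is self-dual if $C=C^\perp=\{x\in\mathbb F_2^n : x\cdot c=0 \text{ for all } c\in C\}$, where $x\cdot c=\sum_i x_ic_i$. An automorphism of $C$ is a permutation of the $n$ coordinates that maps $C$ onto itself. For an odd prime $p$, an automorphism is of type $p$-$(c,f)$ if its decomposition into disjoint cycles consists of exactly $c$ cycles of length $p$ and exactly $f$ fixed points. **Proposition.** There is no binary self-dual $[48,24,10]$ code that has an automorphism of type $3$-$(14,6)$. -/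

import Mathlib

/-- The dual `Cᗮ = {x | x · c = 0 for all c ∈ C}` of a binary linear code `C ⊆ 𝔽₂ⁿ`. -/
def dualCode {n : ℕ} (C : Submodule (ZMod 2) (Fin n → ZMod 2)) :
    Submodule (ZMod 2) (Fin n → ZMod 2) where
  carrier := {x | ∀ c ∈ C, x ⬝ᵥ c = 0}
  add_mem' := by
    intro x y hx hy c hc
    rw [add_dotProduct, hx c hc, hy c hc, add_zero]
  zero_mem' := by
    intro c _
    exact zero_dotProduct c
  smul_mem' := by
    intro a x hx c hc
    rw [smul_dotProduct, hx c hc, smul_zero]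

theorem mem_dualCode {n : ℕ} {C : Submodule (ZMod 2) (Fin n → ZMod 2)} {x : Fin n → ZMod 2} :
    x ∈ dualCode C ↔ ∀ c ∈ C, x ⬝ᵥ c = 0 :=
  Iff.rfl

/-- A binary linear code is self-dual if it equals its dual. -/
def IsSelfDualCode {n : ℕ} (C : Submodule (ZMod 2) (Fin n → ZMod 2)) : Prop :=
  C = dualCode C

/-- `d` is the minimum distance of `C`: the least Hamming distance between two distinct
codewords. -/
def HasMinDistance {n : ℕ} (C : Submodule (ZMod 2) (Fin n → ZMod 2)) (d : ℕ) : Prop :=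
  IsLeast {m : ℕ | ∃ x ∈ C, ∃ y ∈ C, x ≠ y ∧ hammingDist x y = m} d

/-- `C` is a binary linear `[n, k, d]` code: a `k`-dimensional subspace of `𝔽₂ⁿ` with minimum
distance `d`. -/
def IsBinaryCode (n k d : ℕ) (C : Submodule (ZMod 2) (Fin n → ZMod 2)) : Prop :=
  Module.finrank (ZMod 2) C = k ∧ HasMinDistance C d

/-- The coordinate permutation `σ` is an automorphism of `C`: permuting the coordinates of all
codewords by `σ` (coordinate `i` moves to position `σ i`) maps `C` onto itself. -/
def IsCodeAutomorphism {n : ℕ} (σ : Equiv.Perm (Fin n))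
    (C : Submodule (ZMod 2) (Fin n → ZMod 2)) : Prop :=
  (fun v : Fin n → ZMod 2 => fun i => v (σ.symm i)) '' (C : Set (Fin n → ZMod 2)) = C

/-- The permutation `σ` is of type `p`-`(c, f)`: its decomposition into disjoint cycles consists
of exactly `c` cycles of length `p` and exactly `f` fixed points. (Mathlib's `cycleType` is the
multiset of lengths of the nontrivial cycles.) -/
def HasCycleStructure {n : ℕ} (σ : Equiv.Perm (Fin n)) (p c f : ℕ) : Prop :=
  σ.cycleType = Multiset.replicate c p ∧ (Finset.univ.filter fun i => σ i = i).card = f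

/-!
A word fixed by an automorphism `σ` of type `3`-`(14, 6)` is constant on each `3`-cycle, so it is
given by a pair `(a, b) ∈ 𝔽₂¹⁴ × 𝔽₂⁶`, and its weight is `3|a| + |b|`. The pairs that come from the
fixed words of a self-dual code `C` form a self-dual code `F` of length `20`
(`isWeightedSelfDual_comap_expand`), in which `3|a| + |b| ≥ 10` for every nonzero word. There is no
such `F` (`IsWeightedSelfDual.false_of_card`), so the fixed subcode alone rules out `C`; the words
not fixed by `σ` play no part.

Let `F₀ = {a | (a, 0) ∈ F}`. As `|b| ≤ 6 < 10`, every `b` occurs in a word of `F`, so `F₀` has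
dimension at most `4`; and every `a` orthogonal to `F₀` occurs in a word `(a, b)` of `F`, with `b`
unique. Four generators of `F₀` attach to each of the `14` coordinates a column in `𝔽₂⁴`. A zero
column would give a word `(a, b)` with `|a| = 1`, of weight at most `9`. Two equal columns give a
word with `|a| = 2`, hence with `|b| ≥ 4`; if three columns were equal, two such words would have
first parts with odd intersection and second parts with even intersection. So each column occurs
once or twice.

Let `f p` be the multiplicity of the column `p`, modulo `2`. The self-orthogonality of `F₀` says
that `f` is orthogonal to all polynomial functions of degree at most two on `𝔽₂⁴`. So `f` is affine
(the dual of the Reed-Muller code `RM(2, 4)` is `RM(1, 4)`), and `f 0 = 0` makes it linear. Either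
all columns are doubled and there are seven of them, or the eight points off a hyperplane occur once
each and three points of the hyperplane are doubled.

A doubled column `p` gives a word `(eₚ, vₚ)` of `F`, `eₚ` being the indicator of the two
coordinates. The values `vₚ` have weight at least `4` and are pairwise orthogonal, so all of them
lie in a set `{P, Q, P + Q, 1}`, where `P`, `Q`, `P + Q` are the complements of three disjoint pairs
(`exists_frame`).

* If all columns are doubled, take `(a, u) ∈ F`. Orthogonality of `a` to `F₀` says that the doubled
  columns `p` with `vₚ ⬝ᵥ u = 1` sum to zero. Being distinct and nonzero, they are none or at least
  three, and for suitable `u` there is at least one (`three_le_card_filter`). Four choices of `u`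
  cover each of the seven columns twice in total, counting the first choice with multiplicity two,
  so that `14 ≥ 2 · 3 + 3 + 3 + 3`, which is false (`contradiction_of_doubled`).
* If three columns are doubled, the all-one word shows that their values sum to `1`, so two values
  agree, say `vₚ = v_q`. Then `eₚ + e_q ∈ F₀` is the value of a linear functional at the columns,
  and this functional vanishes at the eight points off the hyperplane. These span `𝔽₂⁴`, so it is
  zero (`contradiction_of_affine`).
-/

/-! ### Arithmetic modulo two -/

theorem add_self_zmodTwo {M : Type*} [AddCommGroup M] [Module (ZMod 2) M] (x : M) :
    x + x = 0 := by
  rw [← two_smul (ZMod 2) x, show (2 : ZMod 2) = 0 from rfl, zero_smul]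

theorem zmodTwo_eq_zero_or_one : ∀ x : ZMod 2, x = 0 ∨ x = 1 := by decide

/-! ### Vectors of weight at least four in `𝔽₂⁶` -/

theorem dotProduct_eq_zero_of_heavy : ∀ x y : Fin 6 → ZMod 2, 4 ≤ hammingNorm x →
    4 ≤ hammingNorm y → 4 ≤ hammingNorm (x + y) → x ⬝ᵥ y = 0 := by
  decide +kernel

theorem eq_one_or_hammingNorm_eq_four : ∀ x : Fin 6 → ZMod 2, 4 ≤ hammingNorm x → x ⬝ᵥ x = 0 →
    x = 1 ∨ hammingNorm x = 4 := by
  decide +kernel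

theorem exists_orthogonal_hammingNorm_eq_four : ∀ x : Fin 6 → ZMod 2, hammingNorm x = 4 →
    ∃ y : Fin 6 → ZMod 2, hammingNorm y = 4 ∧ y ≠ x ∧ x ⬝ᵥ y = 0 := by
  decide +kernel

set_option synthInstance.maxSize 1024 in
set_option synthInstance.maxHeartbeats 200000 in
/-- The indices are chosen outside the supports of `x`, `y` and `x + y`, respectively: these
supports are the complements of three disjoint pairs. -/
theorem exists_coordinates : ∀ x : Fin 6 → ZMod 2, hammingNorm x = 4 → ∀ y : Fin 6 → ZMod 2,
    hammingNorm y = 4 → y ≠ x → x ⬝ᵥ y = 0 → ∃ i j k,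
      (x i = 0 ∧ x j = 1 ∧ x k = 1) ∧ y i = 1 ∧ y j = 0 ∧ y k = 1 := by
  decide +kernel

set_option synthInstance.maxSize 1024 in
set_option synthInstance.maxHeartbeats 200000 in
theorem mem_of_orthogonal_pair : ∀ x : Fin 6 → ZMod 2, hammingNorm x = 4 →
    ∀ y : Fin 6 → ZMod 2, hammingNorm y = 4 → y ≠ x → x ⬝ᵥ y = 0 →
    ∀ v : Fin 6 → ZMod 2, 4 ≤ hammingNorm v → v ⬝ᵥ v = 0 → v ⬝ᵥ x = 0 → v ⬝ᵥ y = 0 →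
      v = x ∨ v = y ∨ v = x + y ∨ v = 1 := by
  decide +kernel

theorem hammingNorm_four_self_orthogonal : ∀ x : Fin 6 → ZMod 2, hammingNorm x = 4 →
    x ⬝ᵥ x = 0 := by
  decide +kernel

/-- Pairwise orthogonal (and self-orthogonal) vectors of weight at least four in `𝔽₂⁶`: the
complement of each is empty or a pair, and these pairs are equal or disjoint. So the vectors other
than `1` are among the complements `P`, `Q`, `P + Q` of three disjoint pairs. -/
theorem exists_frame (S : Set (Fin 6 → ZMod 2)) (hS : ∀ v ∈ S, 4 ≤ hammingNorm v)
    (horth : ∀ v ∈ S, ∀ w ∈ S, v ⬝ᵥ w = 0) :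
    ∃ P Q : Fin 6 → ZMod 2, (hammingNorm P = 4 ∧ hammingNorm Q = 4 ∧ Q ≠ P ∧ P ⬝ᵥ Q = 0) ∧
      ∀ v ∈ S, v = P ∨ v = Q ∨ v = P + Q ∨ v = 1 := by
  have four : ∀ v ∈ S, v ≠ 1 → hammingNorm v = 4 := fun v hv h1 =>
    (eq_one_or_hammingNorm_eq_four v (hS v hv) (horth v hv v hv)).resolve_left h1
  by_cases h : ∃ P ∈ S, P ≠ 1
  · obtain ⟨P, hP, hP1⟩ := h
    by_cases h' : ∃ Q ∈ S, Q ≠ 1 ∧ Q ≠ P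
    · obtain ⟨Q, hQ, hQ1, hQP⟩ := h'
      refine ⟨P, Q, ⟨four P hP hP1, four Q hQ hQ1, hQP, horth P hP Q hQ⟩, fun v hv => ?_⟩
      exact mem_of_orthogonal_pair P (four P hP hP1) Q (four Q hQ hQ1) hQP (horth P hP Q hQ) v
        (hS v hv) (horth v hv v hv) (horth v hv P hP) (horth v hv Q hQ)
    · -- only one value differs from `1`, so any orthogonal `Q` completes the frame
      push Not at h'
      obtain ⟨Q, hQ4, hQP, hPQ⟩ := exists_orthogonal_hammingNorm_eq_four P (four P hP hP1)
      refine ⟨P, Q, ⟨four P hP hP1, hQ4, hQP, hPQ⟩, fun v hv => ?_⟩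
      by_cases hv1 : v = 1
      · exact Or.inr (Or.inr (Or.inr hv1))
      · exact Or.inl (h' v hv hv1)
  · push Not at h
    have hP4 : hammingNorm (![1, 1, 1, 1, 0, 0] : Fin 6 → ZMod 2) = 4 := by decide +kernel
    obtain ⟨Q, hQ4, hQP, hPQ⟩ := exists_orthogonal_hammingNorm_eq_four _ hP4
    exact ⟨_, Q, ⟨hP4, hQ4, hQP, hPQ⟩, fun v hv => Or.inr (Or.inr (Or.inr (h v hv)))⟩

/-- As `P + Q + (P + Q) = 0`, three elements of `{P, Q, P + Q, 1}` with sum `1` are `1` together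
with a repeated element. The values at the coordinates `i` and `j` suffice to see this. -/
theorem eq_of_frame {P Q : Fin 6 → ZMod 2} {i j : Fin 6}
    (hP : P i = 0 ∧ P j = 1) (hQ : Q i = 1 ∧ Q j = 0)
    {x y z : Fin 6 → ZMod 2} (hx : x = P ∨ x = Q ∨ x = P + Q ∨ x = 1)
    (hy : y = P ∨ y = Q ∨ y = P + Q ∨ y = 1) (hz : z = P ∨ z = Q ∨ z = P + Q ∨ z = 1)
    (h : x + y + z = 1) : x = y ∨ y = z ∨ x = z := by
  obtain ⟨hPi, hPj⟩ := hP
  obtain ⟨hQi, hQj⟩ := hQ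
  have hi := congrFun h i
  have hj := congrFun h j
  have h11 : (1 : ZMod 2) + 1 = 0 := rfl
  rcases hx with rfl | rfl | rfl | rfl <;> rcases hy with rfl | rfl | rfl | rfl <;>
    rcases hz with rfl | rfl | rfl | rfl <;>
    first
    | exact Or.inl rfl
    | exact Or.inr (Or.inl rfl)
    | exact Or.inr (Or.inr rfl)
    | (exfalso; simp [hPi, hPj, hQi, hQj, h11] at hi hj)

/-! ### Functions on `𝔽₂⁴` -/

theorem sum_fin_four_zmodTwo {M : Type*} [AddCommMonoid M] (g : (Fin 4 → ZMod 2) → M) :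
    ∑ p, g p = ∑ a, ∑ b, ∑ c, ∑ d, g ![a, b, c, d] := by
  let e : (ZMod 2 × ZMod 2 × ZMod 2 × ZMod 2) ≃ (Fin 4 → ZMod 2) :=
    { toFun := fun x => ![x.1, x.2.1, x.2.2.1, x.2.2.2]
      invFun := fun p => (p 0, p 1, p 2, p 3)
      left_inv := fun x => rfl
      right_inv := fun p => by ext i; fin_cases i <;> rfl }
  rw [← e.sum_comp]
  simp only [Fintype.sum_prod_type]
  rfl

theorem sum_zmodTwo {M : Type*} [AddCommMonoid M] (g : ZMod 2 → M) : ∑ a, g a = g 0 + g 1 :=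
  Fin.sum_univ_two g

/-- The dual of the Reed-Muller code `RM(2, 4)` is `RM(1, 4)`: a function on `𝔽₂⁴` that is
orthogonal to all polynomial functions of degree at most two is affine. Linear monomials need no
separate hypothesis, since `p a * p a = p a`. -/
theorem eq_dotProduct_of_orthogonal_quadratic (f : (Fin 4 → ZMod 2) → ZMod 2) (h0 : f 0 = 0)
    (hsum : ∑ p, f p = 0) (hquad : ∀ a b, ∑ p, f p * (p a * p b) = 0) :
    ∃ l : Fin 4 → ZMod 2, ∀ p, f p = l ⬝ᵥ p := by
  refine ⟨![f ![1, 0, 0, 0], f ![0, 1, 0, 0], f ![0, 0, 1, 0], f ![0, 0, 0, 1]], ?_⟩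
  have h0' : f ![0, 0, 0, 0] = 0 := by
    rw [show (![0, 0, 0, 0] : Fin 4 → ZMod 2) = 0 by ext i; fin_cases i <;> rfl, h0]
  have q00 := hquad 0 0
  have q11 := hquad 1 1
  have q22 := hquad 2 2
  have q33 := hquad 3 3
  have q01 := hquad 0 1
  have q02 := hquad 0 2
  have q03 := hquad 0 3
  have q12 := hquad 1 2
  have q13 := hquad 1 3
  have q23 := hquad 2 3
  simp [sum_fin_four_zmodTwo, sum_zmodTwo, h0'] at hsum q00 q11 q22 q33 q01 q02 q03 q12 q13 q23
  suffices H : ∀ a b c d : ZMod 2, f ![a, b, c, d] =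
      f ![1, 0, 0, 0] * a + f ![0, 1, 0, 0] * b + f ![0, 0, 1, 0] * c + f ![0, 0, 0, 1] * d by
    intro p
    have hp : p = ![p 0, p 1, p 2, p 3] := by ext i; fin_cases i <;> rfl
    rw [hp, H]
    simp [dotProduct, Fin.sum_univ_four]
  intro a b c d
  rcases zmodTwo_eq_zero_or_one a with rfl | rfl <;>
  rcases zmodTwo_eq_zero_or_one b with rfl | rfl <;>
  rcases zmodTwo_eq_zero_or_one c with rfl | rfl <;>
  rcases zmodTwo_eq_zero_or_one d with rfl | rfl <;>
  simp only [mul_zero, mul_one, add_zero, zero_add, h0'] <;> grind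

/-- The complement of a hyperplane spans `𝔽₂⁴`. -/
theorem eq_zero_of_vanish_affine : ∀ l : Fin 4 → ZMod 2, l ≠ 0 → ∀ m : Fin 4 → ZMod 2,
    (∀ s : Fin 4 → ZMod 2, l ⬝ᵥ s = 1 → m ⬝ᵥ s = 0) → m = 0 := by
  decide +kernel

theorem card_affine_hyperplane : ∀ l : Fin 4 → ZMod 2, l ≠ 0 →
    (Finset.univ.filter fun s => l ⬝ᵥ s = 1).card = 8 := by
  decide +kernel

/-! ### Self-dual codes with a weighted distance condition -/

theorem exists_eq_dotProduct {m : Type*} [Fintype m] (φ : (m → ZMod 2) →ₗ[ZMod 2] ZMod 2) :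
    ∃ b : m → ZMod 2, ∀ t, φ t = b ⬝ᵥ t := by
  classical
  refine ⟨fun j => φ (Pi.single j 1), fun t => ?_⟩
  conv_lhs => rw [← Finset.univ_sum_single t, map_sum]
  refine Finset.sum_congr rfl fun j _ => ?_
  have e : (Pi.single j (t j) : m → ZMod 2) = t j • Pi.single j 1 := by
    rw [← Pi.single_smul, smul_eq_mul, mul_one]
  rw [e, map_smul, smul_eq_mul, mul_comm]

/-- The code `F`, of length `|I| + 6`, is self-dual, and each of its nonzero words `(a, b)`
satisfies `3|a| + |b| ≥ 10`. Orthogonality of `(a, b)` and `(a', b')` is written as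
`a ⬝ᵥ a' = b ⬝ᵥ b'`, which is the same as `a ⬝ᵥ a' + b ⬝ᵥ b' = 0` in characteristic two. -/
structure IsWeightedSelfDual {I : Type*} [Fintype I]
    (F : Submodule (ZMod 2) ((I → ZMod 2) × (Fin 6 → ZMod 2))) : Prop where
  dot_eq : ∀ x ∈ F, ∀ y ∈ F, x.1 ⬝ᵥ y.1 = x.2 ⬝ᵥ y.2
  mem_of_dot_eq : ∀ x, (∀ y ∈ F, x.1 ⬝ᵥ y.1 = x.2 ⬝ᵥ y.2) → x ∈ F
  weight : ∀ x ∈ F, x ≠ 0 → 10 ≤ 3 * hammingNorm x.1 + hammingNorm x.2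

/-- The subcode `{a | (a, 0) ∈ F}` is generated by the four words `fun i => col i k`. They need not
be linearly independent. The vector `col i` is the `i`-th column of the generator matrix. -/
def GeneratedBy {I : Type*} (F : Submodule (ZMod 2) ((I → ZMod 2) × (Fin 6 → ZMod 2)))
    (col : I → Fin 4 → ZMod 2) : Prop :=
  ∀ a : I → ZMod 2, (a, (0 : Fin 6 → ZMod 2)) ∈ F ↔ ∃ m : Fin 4 → ZMod 2, ∀ i, a i = m ⬝ᵥ col i

namespace IsWeightedSelfDual

variable {I : Type*} [Fintype I] {F : Submodule (ZMod 2) ((I → ZMod 2) × (Fin 6 → ZMod 2))}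

theorem snd_eq_zero (hF : IsWeightedSelfDual F) {b : Fin 6 → ZMod 2} (h : (0, b) ∈ F) :
    b = 0 := by
  by_contra hb
  have h1 := hF.weight _ h (by simpa [Prod.ext_iff] using hb)
  have h2 : hammingNorm b ≤ 6 := by simpa using hammingNorm_le_card_fintype (x := b)
  simp at h1
  omega

theorem one_mem (hF : IsWeightedSelfDual F) : ((1, 1) : (I → ZMod 2) × (Fin 6 → ZMod 2)) ∈ F := by
  refine hF.mem_of_dot_eq _ fun y hy => ?_
  have h := hF.dot_eq y hy y hy
  have hsq : ∀ x : ZMod 2, x * x = x := by decide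
  simpa [dotProduct, hsq] using h

/-- If a nonzero functional `b` vanished on the second parts, then `(0, b)` would be a word of `F`,
of weight at most `6`. -/
theorem exists_fst (hF : IsWeightedSelfDual F) (u : Fin 6 → ZMod 2) : ∃ a, (a, u) ∈ F := by
  classical
  set R := F.map (LinearMap.snd (ZMod 2) (I → ZMod 2) (Fin 6 → ZMod 2)) with hR
  have htop : R = ⊤ := by
    by_contra hne
    obtain ⟨φ, hφ, hle⟩ := Submodule.exists_le_ker_of_lt_top R (lt_top_iff_ne_top.2 hne)
    obtain ⟨b, hb⟩ := exists_eq_dotProduct φ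
    have hmem : ((0, b) : (I → ZMod 2) × (Fin 6 → ZMod 2)) ∈ F := by
      refine hF.mem_of_dot_eq _ fun y hy => ?_
      have : φ y.2 = 0 := hle (Submodule.mem_map_of_mem (f := LinearMap.snd _ _ _) hy)
      rw [hb] at this
      simp [this]
    have hb0 := hF.snd_eq_zero hmem
    exact hφ (LinearMap.ext fun t => by simp [hb, hb0])
  have hu : u ∈ R := htop ▸ Submodule.mem_top
  obtain ⟨x, hx, rfl⟩ := Submodule.mem_map.1 hu
  exact ⟨x.1, hx⟩

/-- Words orthogonal to the subcode `{c | (c, 0) ∈ F}` are the first parts of words of `F`: on `F`,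
the functional `x ↦ a ⬝ᵥ x.1` depends only on `x.2`. -/
theorem exists_snd (hF : IsWeightedSelfDual F) (a : I → ZMod 2)
    (ha : ∀ c, (c, (0 : Fin 6 → ZMod 2)) ∈ F → a ⬝ᵥ c = 0) : ∃ b, (a, b) ∈ F := by
  choose s hs using hF.exists_fst
  -- the functional `t ↦ a ⬝ᵥ s t` does not depend on the choice of `s t`
  have key : ∀ x ∈ F, a ⬝ᵥ x.1 = a ⬝ᵥ s x.2 := by
    intro x hx
    have h : x - (s x.2, x.2) ∈ F := F.sub_mem hx (hs _)
    have h' : (x.1 - s x.2, (0 : Fin 6 → ZMod 2)) ∈ F := by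
      have e : x - (s x.2, x.2) = (x.1 - s x.2, 0) := by ext <;> simp
      rwa [e] at h
    have := ha _ h'
    rwa [dotProduct_sub, sub_eq_zero] at this
  let φ : (Fin 6 → ZMod 2) →ₗ[ZMod 2] ZMod 2 :=
    { toFun := fun t => a ⬝ᵥ s t
      map_add' := fun t u => by
        rw [← dotProduct_add]
        exact (key _ (F.add_mem (hs t) (hs u))).symm
      map_smul' := fun r t => by
        rw [← dotProduct_smul]
        exact (key _ (F.smul_mem r (hs t))).symm }
  obtain ⟨b, hb⟩ := exists_eq_dotProduct φ
  refine ⟨b, hF.mem_of_dot_eq _ fun y hy => ?_⟩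
  rw [← hb]
  exact key y hy

/-- The dot product embeds the self-orthogonal code `F` into its annihilator, and the two dimensions
add up to `20`. -/
theorem finrank_le (hF : IsWeightedSelfDual F) (hI : Fintype.card I = 14) :
    Module.finrank (ZMod 2) F ≤ 10 := by
  classical
  let B : ((I → ZMod 2) × (Fin 6 → ZMod 2)) →ₗ[ZMod 2]
      Module.Dual (ZMod 2) ((I → ZMod 2) × (Fin 6 → ZMod 2)) :=
    LinearMap.mk₂ (ZMod 2) (fun x y => x.1 ⬝ᵥ y.1 + x.2 ⬝ᵥ y.2)
      (fun x y z => by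
        rw [Prod.fst_add, Prod.snd_add, add_dotProduct, add_dotProduct, add_add_add_comm])
      (fun c x y => by
        rw [Prod.smul_fst, Prod.smul_snd, smul_dotProduct, smul_dotProduct, smul_add])
      (fun x y z => by
        rw [Prod.fst_add, Prod.snd_add, dotProduct_add, dotProduct_add, add_add_add_comm])
      (fun c x y => by
        rw [Prod.smul_fst, Prod.smul_snd, dotProduct_smul, dotProduct_smul, smul_add])
  have hB : ∀ x y, B x y = x.1 ⬝ᵥ y.1 + x.2 ⬝ᵥ y.2 := fun x y => rfl
  have hinj : Function.Injective B := by
    rw [injective_iff_map_eq_zero]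
    intro x hx
    ext i
    · have := hB x (Pi.single i 1, 0)
      simpa [hx] using this.symm
    · have := hB x (0, Pi.single i 1)
      simpa [hx] using this.symm
  have hle : F.map B ≤ F.dualAnnihilator := by
    rintro _ ⟨x, hx, rfl⟩
    rw [Submodule.mem_dualAnnihilator]
    intro y hy
    rw [hB, hF.dot_eq x hx y hy]
    exact add_self_zmodTwo _
  have h1 : Module.finrank (ZMod 2) (F.map B) = Module.finrank (ZMod 2) F :=
    (Submodule.equivMapOfInjective B hinj F).symm.finrank_eq
  have h2 := Submodule.finrank_mono hle
  have h3 := Subspace.finrank_add_finrank_dualAnnihilator_eq F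
  have h4 : Module.finrank (ZMod 2) ((I → ZMod 2) × (Fin 6 → ZMod 2)) = 20 := by simp [hI]
  omega

theorem exists_generators (hF : IsWeightedSelfDual F) (hI : Fintype.card I = 14) :
    ∃ col : I → Fin 4 → ZMod 2, GeneratedBy F col := by
  classical
  let g : F →ₗ[ZMod 2] (Fin 6 → ZMod 2) := (LinearMap.snd _ _ _).comp F.subtype
  have hg : LinearMap.range g = ⊤ := by
    rw [LinearMap.range_eq_top]
    intro u
    obtain ⟨a, ha⟩ := hF.exists_fst u
    exact ⟨⟨_, ha⟩, rfl⟩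
  have h1 := LinearMap.finrank_range_add_finrank_ker g
  rw [hg, finrank_top] at h1
  have h2 := hF.finrank_le hI
  have h4 : Module.finrank (ZMod 2) (Fin 6 → ZMod 2) = 6 := by simp
  have h3 : Module.finrank (ZMod 2) (LinearMap.ker g) ≤ 4 := by omega
  let b := Module.finBasis (ZMod 2) (LinearMap.ker g)
  set r := Module.finrank (ZMod 2) (LinearMap.ker g) with hr
  let w : Fin r → I → ZMod 2 := fun k => ((b k : F) : (I → ZMod 2) × (Fin 6 → ZMod 2)).1
  have hw : ∀ k, (w k, (0 : Fin 6 → ZMod 2)) ∈ F := fun k => by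
    have h0 : ((b k : F) : (I → ZMod 2) × (Fin 6 → ZMod 2)).2 = 0 := (b k).2
    have := (b k : F).2
    rw [← Prod.mk.eta (p := ((b k : F) : (I → ZMod 2) × (Fin 6 → ZMod 2))), h0] at this
    exact this
  -- pad the basis by zeros to four vectors
  refine ⟨fun i k => if h : k.1 < r then w ⟨k, h⟩ i else 0, fun a => ⟨fun ha => ?_, ?_⟩⟩
  · let x : LinearMap.ker g := ⟨⟨_, ha⟩, rfl⟩
    refine ⟨fun k => if h : k.1 < r then b.repr x ⟨k, h⟩ else 0, fun i => ?_⟩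
    have hx := congrArg (fun y : LinearMap.ker g =>
      ((y : F) : (I → ZMod 2) × (Fin 6 → ZMod 2)).1 i) (b.sum_repr x)
    simp only [Submodule.coe_sum, Prod.fst_sum, Finset.sum_apply, Submodule.coe_smul,
      Prod.smul_fst, Pi.smul_apply, smul_eq_mul] at hx
    have e : a i = ∑ k : Fin r, b.repr x k * w k i := hx.symm
    rw [e, dotProduct]
    refine Finset.sum_of_injOn (Fin.castLE h3) (by simp [Set.InjOn]) (by simp) ?_ ?_
    · intro k _ hk
      rw [dif_neg, zero_mul]
      intro hlt
      exact hk ⟨⟨k, hlt⟩, by simp, by ext; simp⟩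
    · intro k _
      simp
  · rintro ⟨m, hm⟩
    have e : (a, (0 : Fin 6 → ZMod 2)) = ∑ k : Fin 4, m k •
        ((fun i => if h : k.1 < r then w ⟨k, h⟩ i else 0, 0) :
          (I → ZMod 2) × (Fin 6 → ZMod 2)) := by
      ext i
      · simp [Prod.fst_sum, hm, dotProduct]
      · simp [Prod.snd_sum]
    rw [e]
    refine F.sum_mem fun k _ => F.smul_mem _ ?_
    by_cases h : k.1 < r
    · simpa [h] using hw ⟨k, h⟩
    · simp only [h, dite_false]
      exact F.zero_mem

end IsWeightedSelfDual

/-! ### Columns of the subcode vanishing on the fixed points -/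

theorem GeneratedBy.col_apply_mem {I : Type*}
    {F : Submodule (ZMod 2) ((I → ZMod 2) × (Fin 6 → ZMod 2))} {col : I → Fin 4 → ZMod 2}
    (hcol : GeneratedBy F col) (k : Fin 4) :
    ((fun i => col i k, 0) : (I → ZMod 2) × (Fin 6 → ZMod 2)) ∈ F :=
  (hcol _).2 ⟨Pi.single k 1, fun i => by simp⟩

/-- The coordinates with column `p`. -/
def columnFiber {I : Type*} [Fintype I] (col : I → Fin 4 → ZMod 2) (p : Fin 4 → ZMod 2) :
    Finset I :=
  Finset.univ.filter fun i => col i = p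

/-- The indicator word of the set of coordinates with column `p`. -/
def fiberWord {I : Type*} (col : I → Fin 4 → ZMod 2) (p : Fin 4 → ZMod 2) : I → ZMod 2 :=
  fun i => if col i = p then 1 else 0

section

variable {I : Type*} [Fintype I] {col : I → Fin 4 → ZMod 2}

theorem mem_columnFiber {p : Fin 4 → ZMod 2} {i : I} :
    i ∈ columnFiber col p ↔ col i = p := by simp [columnFiber]

theorem sum_columnFiber {M : Type*} [AddCommMonoid M] (g : I → M) :
    ∑ p, ∑ i ∈ columnFiber col p, g i = ∑ i, g i :=
  Finset.sum_fiberwise _ _ _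

theorem fiberWord_dotProduct (p : Fin 4 → ZMod 2) (a : I → ZMod 2) :
    fiberWord col p ⬝ᵥ a = ∑ i ∈ columnFiber col p, a i := by
  simp [dotProduct, fiberWord, columnFiber, Finset.sum_filter]

end

namespace IsWeightedSelfDual

variable {I : Type*} [Fintype I]
  {F : Submodule (ZMod 2) ((I → ZMod 2) × (Fin 6 → ZMod 2))} {col : I → Fin 4 → ZMod 2}

theorem exists_snd_of_sum_smul (hF : IsWeightedSelfDual F) (hcol : GeneratedBy F col)
    {a : I → ZMod 2} (ha : ∑ i, a i • col i = 0) : ∃ b, (a, b) ∈ F := by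
  refine hF.exists_snd a fun c hc => ?_
  obtain ⟨m, hm⟩ := (hcol c).1 hc
  have h : m ⬝ᵥ ∑ i, a i • col i = ∑ i, a i * (m ⬝ᵥ col i) := by
    rw [dotProduct_sum]
    exact Finset.sum_congr rfl fun i _ => dotProduct_smul _ _ _
  rw [ha, dotProduct_zero] at h
  simp only [dotProduct] at h ⊢
  rw [h]
  exact Finset.sum_congr rfl fun i _ => by rw [hm]; rfl

theorem sum_smul_col (hF : IsWeightedSelfDual F) (hcol : GeneratedBy F col) {a : I → ZMod 2}
    {b : Fin 6 → ZMod 2} (hab : (a, b) ∈ F) : ∑ i, a i • col i = 0 := by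
  ext k
  have h := hF.dot_eq _ hab _ (hcol.col_apply_mem k)
  simpa [dotProduct, Finset.sum_apply] using h

/-- A zero column would give a word `(a, b)` of `F` with `|a| = 1`, so that `3|a| + |b| ≤ 9`. -/
theorem col_ne_zero (hF : IsWeightedSelfDual F) (hcol : GeneratedBy F col) (i : I) :
    col i ≠ 0 := by
  classical
  intro h
  obtain ⟨b, hb⟩ := hF.exists_snd_of_sum_smul hcol (a := Pi.single i 1) (by
    simp [Pi.single_apply, h])
  have h1 := hF.weight _ hb (fun h0 => by simpa using congrFun (congrArg Prod.fst h0) i)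
  have h2 : hammingNorm b ≤ 6 := by simpa using hammingNorm_le_card_fintype (x := b)
  have h3 : hammingNorm (Pi.single i 1 : I → ZMod 2) = 1 := by
    rw [hammingNorm, Finset.card_eq_one]
    exact ⟨i, by ext t; simp [Pi.single_apply]⟩
  simp only [h3] at h1
  omega

theorem exists_heavy [DecidableEq I] (hF : IsWeightedSelfDual F) (hcol : GeneratedBy F col)
    {i j : I} (hij : i ≠ j) (h : col i = col j) :
    ∃ b, (Pi.single i 1 + Pi.single j 1, b) ∈ F ∧ 4 ≤ hammingNorm b := by
  obtain ⟨b, hb⟩ := hF.exists_snd_of_sum_smul hcol (a := Pi.single i 1 + Pi.single j 1) (by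
    simp [Pi.single_apply, add_smul, Finset.sum_add_distrib, h, add_self_zmodTwo])
  refine ⟨b, hb, ?_⟩
  have h1 := hF.weight _ hb (fun h0 => by simpa [hij] using congrFun (congrArg Prod.fst h0) i)
  have h3 : hammingNorm (Pi.single i 1 + Pi.single j 1 : I → ZMod 2) ≤ 2 := by
    calc _ ≤ ({i, j} : Finset I).card := Finset.card_le_card fun t ht => by
            by_contra hn
            simp only [Finset.mem_insert, Finset.mem_singleton, not_or] at hn
            simp [Pi.single_apply, hn.1, hn.2] at ht
      _ ≤ 2 := Finset.card_le_two
  simp only at h1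
  omega

/-- If the coordinates `i`, `j`, `k` had the same column, the pairs `{i, j}`, `{j, k}`, `{i, k}`
would be the first parts of words of `F` with second parts `b`, `c`, `b + c` of weight at least
four. This forces `b ⬝ᵥ c = 0`, whereas `{i, j}` and `{j, k}` meet in one coordinate. -/
theorem card_columnFiber_le (hF : IsWeightedSelfDual F) (hcol : GeneratedBy F col)
    (p : Fin 4 → ZMod 2) : (columnFiber col p).card ≤ 2 := by
  classical
  by_contra! h
  obtain ⟨i, hi, j, hj, k, hk, hij, hik, hjk⟩ := Finset.two_lt_card.1 h
  rw [mem_columnFiber] at hi hj hk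
  obtain ⟨b, hb, hb4⟩ := hF.exists_heavy hcol hij (hi.trans hj.symm)
  obtain ⟨c, hc, hc4⟩ := hF.exists_heavy hcol hjk (hj.trans hk.symm)
  obtain ⟨d, hd, hd4⟩ := hF.exists_heavy hcol hik (hi.trans hk.symm)
  have hsum : b + c + d = 0 := by
    refine hF.snd_eq_zero ?_
    have h := F.add_mem (F.add_mem hb hc) hd
    have e : (Pi.single i 1 + Pi.single j 1 + (Pi.single j 1 + Pi.single k 1) +
        (Pi.single i 1 + Pi.single k 1) : I → ZMod 2) = 0 := by
      have e1 := add_self_zmodTwo (Pi.single i 1 : I → ZMod 2)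
      have e2 := add_self_zmodTwo (Pi.single j 1 : I → ZMod 2)
      have e3 := add_self_zmodTwo (Pi.single k 1 : I → ZMod 2)
      linear_combination (exp := 1) e1 + e2 + e3
    rwa [Prod.mk_add_mk, Prod.mk_add_mk, e] at h
  have hd' : d = b + c := by
    have := add_self_zmodTwo d
    linear_combination (exp := 1) this - hsum
  have h0 := dotProduct_eq_zero_of_heavy b c hb4 hc4 (hd' ▸ hd4)
  have h1 := hF.dot_eq _ hb _ hc
  simp [h0, dotProduct_add, hij.symm, hik.symm, hjk.symm] at h1

/-- Modulo two, the multiplicity of a column is a linear function of the column. -/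
theorem exists_odd_functional (hF : IsWeightedSelfDual F) (hcol : GeneratedBy F col)
    (hI : Fintype.card I = 14) :
    ∃ l : Fin 4 → ZMod 2, ∀ p, ((columnFiber col p).card : ZMod 2) = l ⬝ᵥ p := by
  have key : ∀ g : (Fin 4 → ZMod 2) → ZMod 2,
      ∑ p, ((columnFiber col p).card : ZMod 2) * g p = ∑ i, g (col i) := fun g => by
    rw [← sum_columnFiber (col := col)]
    refine Finset.sum_congr rfl fun p _ => ?_
    rw [← nsmul_eq_mul, ← Finset.sum_const]
    exact Finset.sum_congr rfl fun i hi => by rw [mem_columnFiber.1 hi]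
  refine eq_dotProduct_of_orthogonal_quadratic _ ?_ ?_ fun a b => ?_
  · have : columnFiber col 0 = ∅ := by
      simp [columnFiber, hF.col_ne_zero hcol]
    simp [this]
  · have := key 1
    simp only [Pi.one_apply, mul_one] at this
    rw [this, Finset.sum_const, Finset.card_univ, hI]
    rfl
  · rw [key fun p => p a * p b]
    simpa [dotProduct] using hF.dot_eq _ (hcol.col_apply_mem a) _ (hcol.col_apply_mem b)

theorem exists_pair_value (hF : IsWeightedSelfDual F) (hcol : GeneratedBy F col) :
    ∃ v : (Fin 4 → ZMod 2) → Fin 6 → ZMod 2, ∀ p, (columnFiber col p).card = 2 →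
      (fiberWord col p, v p) ∈ F ∧ 4 ≤ hammingNorm (v p) := by
  suffices h : ∀ p, ∃ v : Fin 6 → ZMod 2, (columnFiber col p).card = 2 →
      (fiberWord col p, v) ∈ F ∧ 4 ≤ hammingNorm v from Classical.axiomOfChoice h
  classical
  intro p
  by_cases hp : (columnFiber col p).card = 2
  · obtain ⟨i, j, hij, he⟩ := Finset.card_eq_two.1 hp
    have hi : col i = p := mem_columnFiber.1 (he ▸ by simp)
    have hj : col j = p := mem_columnFiber.1 (he ▸ by simp)
    obtain ⟨b, hb, hb4⟩ := hF.exists_heavy hcol hij (hi.trans hj.symm)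
    have e : fiberWord col p = Pi.single i 1 + Pi.single j 1 := by
      ext t
      have ht : col t = p ↔ t = i ∨ t = j := by rw [← mem_columnFiber, he]; simp
      simp only [fiberWord, ht, Pi.add_apply, Pi.single_apply]
      by_cases hti : t = i
      · simp [hti, hij]
      · simp [hti]
    exact ⟨b, fun _ => ⟨e ▸ hb, hb4⟩⟩
  · exact ⟨0, fun h => absurd h hp⟩

/-! ### Nonexistence of the contracted code -/

/-- Suppose every column that occurs is doubled. For `(a, u) ∈ F`, the columns `p` with
`v p ⬝ᵥ u = 1` are those whose two coordinates have different values in `a`, and they sum to zero because `a` is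
orthogonal to the generators. Hence their number is not one or two. If it were zero, `a` would be
constant on each column fiber; so would be `c` for `(c, w) ∈ F`, which makes `c ⬝ᵥ a = 0` although
`w ⬝ᵥ u = 1`. -/
theorem three_le_card_filter (hF : IsWeightedSelfDual F) (hcol : GeneratedBy F col)
    {v : (Fin 4 → ZMod 2) → Fin 6 → ZMod 2} {D : Finset (Fin 4 → ZMod 2)}
    (hD : ∀ p ∈ D, (columnFiber col p).card = 2) (hD' : ∀ p ∉ D, columnFiber col p = ∅)
    (hv : ∀ p ∈ D, (fiberWord col p, v p) ∈ F) {u w : Fin 6 → ZMod 2}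
    (hw : ∀ p ∈ D, v p ⬝ᵥ w = 0) (hwu : w ⬝ᵥ u = 1) :
    3 ≤ (D.filter fun p => v p ⬝ᵥ u = 1).card := by
  classical
  obtain ⟨a, ha⟩ := hF.exists_fst u
  obtain ⟨c, hc⟩ := hF.exists_fst w
  have hsum : ∀ {b : I → ZMod 2} {t}, (b, t) ∈ F → ∀ p ∈ D,
      ∑ i ∈ columnFiber col p, b i = v p ⬝ᵥ t := fun hb p hp => by
    rw [← fiberWord_dotProduct]
    exact hF.dot_eq _ (hv p hp) _ hb
  have hpoint : ∑ p ∈ D.filter (fun p => v p ⬝ᵥ u = 1), p = 0 := by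
    have h := hF.sum_smul_col hcol ha
    rw [← sum_columnFiber (col := col)] at h
    rw [Finset.sum_filter]
    refine Eq.trans ?_ h
    rw [← Finset.sum_subset (Finset.subset_univ D)]
    · refine Finset.sum_congr rfl fun p hp => ?_
      have e : ∑ i ∈ columnFiber col p, a i • col i = (v p ⬝ᵥ u) • p := by
        rw [← hsum ha p hp, Finset.sum_smul]
        exact Finset.sum_congr rfl fun i hi => by rw [mem_columnFiber.1 hi]
      rw [e]
      rcases zmodTwo_eq_zero_or_one (v p ⬝ᵥ u) with h0 | h0 <;> simp [h0]
    · intro p _ hp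
      rw [hD' p hp, Finset.sum_empty]
  have hne : ∀ p ∈ D, p ≠ 0 := fun p hp h0 => by
    obtain ⟨i, hi⟩ : (columnFiber col p).Nonempty := Finset.card_pos.1 (by rw [hD p hp]; omega)
    exact hF.col_ne_zero hcol i ((mem_columnFiber.1 hi).trans h0)
  by_contra! hlt
  have hcases : (D.filter fun p => v p ⬝ᵥ u = 1).card = 0 ∨
      (D.filter fun p => v p ⬝ᵥ u = 1).card = 1 ∨
      (D.filter fun p => v p ⬝ᵥ u = 1).card = 2 := by omega
  rcases hcases with h0 | h1 | h2
  · have hDu : ∀ p ∈ D, v p ⬝ᵥ u = 0 := fun p hp => by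
      rcases zmodTwo_eq_zero_or_one (v p ⬝ᵥ u) with h | h
      · exact h
      · exact absurd (Finset.mem_filter.2 ⟨hp, h⟩)
          (Finset.card_eq_zero.1 h0 ▸ Finset.notMem_empty p)
    have hac : c ⬝ᵥ a = 1 := (hF.dot_eq _ hc _ ha).trans hwu
    have : c ⬝ᵥ a = 0 := by
      rw [dotProduct, ← sum_columnFiber (col := col)]
      refine Finset.sum_eq_zero fun p _ => ?_
      by_cases hp : p ∈ D
      · obtain ⟨i, j, hij, he⟩ := Finset.card_eq_two.1 (hD p hp)
        have h1 := hsum hc p hp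
        have h2 := hsum ha p hp
        rw [hw p hp, he, Finset.sum_pair hij] at h1
        rw [hDu p hp, he, Finset.sum_pair hij] at h2
        rw [he, Finset.sum_pair hij]
        generalize c i = c1 at *
        generalize c j = c2 at *
        generalize a i = a1 at *
        generalize a j = a2 at *
        revert c1 c2 a1 a2
        clear * -
        decide
      · rw [hD' p hp, Finset.sum_empty]
    rw [hac] at this
    exact one_ne_zero this
  · obtain ⟨p, hp⟩ := Finset.card_eq_one.1 h1
    rw [hp, Finset.sum_singleton] at hpoint
    exact hne p (Finset.mem_filter.1 (hp ▸ Finset.mem_singleton_self p)).1 hpoint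
  · obtain ⟨p, q, hpq, he⟩ := Finset.card_eq_two.1 h2
    rw [he, Finset.sum_pair hpq] at hpoint
    have := add_self_zmodTwo q
    exact hpq (by linear_combination (exp := 1) hpoint - this)

/-- Not every column is doubled. -/
theorem contradiction_of_doubled (hF : IsWeightedSelfDual F) (hcol : GeneratedBy F col)
    (hI : Fintype.card I = 14) (heven : ∀ p, ((columnFiber col p).card : ZMod 2) = 0)
    {v : (Fin 4 → ZMod 2) → Fin 6 → ZMod 2}
    (hv : ∀ p, (columnFiber col p).card = 2 → (fiberWord col p, v p) ∈ F)
    {P Q : Fin 6 → ZMod 2} (hP : hammingNorm P = 4) (hQ : hammingNorm Q = 4) (hQP : Q ≠ P)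
    (hPQ : P ⬝ᵥ Q = 0)
    (hval : ∀ p, (columnFiber col p).card = 2 → v p = P ∨ v p = Q ∨ v p = P + Q ∨ v p = 1) :
    False := by
  obtain ⟨i, j, k, ⟨hPi, hPj, hPk⟩, hQi, hQj, hQk⟩ := exists_coordinates P hP Q hQ hQP hPQ
  have hPP := hammingNorm_four_self_orthogonal P hP
  have hQQ := hammingNorm_four_self_orthogonal Q hQ
  have hone : ∀ x : Fin 6 → ZMod 2, x ⬝ᵥ 1 = x ⬝ᵥ x := fun x => by
    have hsq : ∀ y : ZMod 2, y * y = y := by decide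
    simp [dotProduct, hsq]
  have hP1 : P ⬝ᵥ 1 = 0 := (hone P).trans hPP
  have hQ1 : Q ⬝ᵥ 1 = 0 := (hone Q).trans hQQ
  have h11 : (1 : Fin 6 → ZMod 2) ⬝ᵥ 1 = 0 := by decide
  have hQP' : Q ⬝ᵥ P = 0 := by rw [dotProduct_comm, hPQ]
  set D := Finset.univ.filter fun p => (columnFiber col p).card = 2 with hDdef
  have hD : ∀ p ∈ D, (columnFiber col p).card = 2 := fun p hp => (Finset.mem_filter.1 hp).2
  have hD' : ∀ p ∉ D, columnFiber col p = ∅ := fun p hp => by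
    have h2 := hF.card_columnFiber_le hcol p
    have h1 := (ZMod.natCast_eq_zero_iff_even).1 (heven p)
    have hne : (columnFiber col p).card ≠ 2 := fun h => hp (by simp [hDdef, h])
    rw [← Finset.card_eq_zero]
    obtain ⟨r, hr⟩ := h1
    omega
  have hcard : D.card = 7 := by
    have h : ∑ p, (columnFiber col p).card = 14 := by
      simp only [Finset.card_eq_sum_ones, sum_columnFiber]
      simp [hI]
    rw [← Finset.sum_subset (Finset.subset_univ D) fun p _ hp => by rw [hD' p hp]; rfl,
      Finset.sum_congr rfl hD, Finset.sum_const, smul_eq_mul] at h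
    omega
  have hvD : ∀ p ∈ D, (fiberWord col p, v p) ∈ F := fun p hp => hv p (hD p hp)
  have hvalD := fun p hp => hval p (hD p hp)
  have orth : ∀ w, P ⬝ᵥ w = 0 → Q ⬝ᵥ w = 0 → (1 : Fin 6 → ZMod 2) ⬝ᵥ w = 0 →
      ∀ p ∈ D, v p ⬝ᵥ w = 0 := fun w h1 h2 h3 p hp => by
    rcases hvalD p hp with h | h | h | h <;> simp [h, h1, h2, h3, add_dotProduct]
  have h2 : (1 : ZMod 2) + 1 = 0 := rfl
  -- each `w` below is orthogonal to all values `v p` but not to the corresponding `u`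
  have t0 := hF.three_le_card_filter hcol hD hD' hvD
    (u := Pi.single i 1 + Pi.single j 1 + Pi.single k 1)
    (orth 1 hP1 hQ1 h11) (by simp [dotProduct_add, h2])
  have t1 := hF.three_le_card_filter hcol hD hD' hvD (u := Pi.single i 1 + Pi.single j 1)
    (orth P hPP hQP' (by rw [dotProduct_comm, hP1])) (by simp [dotProduct_add, hPi, hPj])
  have t2 := hF.three_le_card_filter hcol hD hD' hvD (u := Pi.single i 1 + Pi.single k 1)
    (orth P hPP hQP' (by rw [dotProduct_comm, hP1])) (by simp [dotProduct_add, hPi, hPk])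
  have t3 := hF.three_le_card_filter hcol hD hD' hvD (u := Pi.single j 1 + Pi.single k 1)
    (orth Q hPQ hQQ (by rw [dotProduct_comm, hQ1])) (by simp [dotProduct_add, hQj, hQk])
  -- `P`, `Q`, `P + Q` and `1` take the values `(0, 1, 1)`, `(1, 0, 1)`, `(1, 1, 0)` and `(1, 1, 1)`
  -- at `(i, j, k)`: the first three meet two of the three two-term tests each, and the last one
  -- meets only the three-term test
  have total : ∑ p ∈ D,
      (2 * (if v p ⬝ᵥ (Pi.single i 1 + Pi.single j 1 + Pi.single k 1) = 1 then 1 else 0)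
      + (if v p ⬝ᵥ (Pi.single i 1 + Pi.single j 1) = 1 then 1 else 0)
      + (if v p ⬝ᵥ (Pi.single i 1 + Pi.single k 1) = 1 then 1 else 0)
      + (if v p ⬝ᵥ (Pi.single j 1 + Pi.single k 1) = 1 then 1 else 0)) = ∑ p ∈ D, 2 := by
    refine Finset.sum_congr rfl fun p hp => ?_
    rcases hvalD p hp with h | h | h | h <;>
      simp [h, dotProduct_add, hPi, hPj, hPk, hQi, hQj, hQk, h2]
  rw [Finset.sum_add_distrib, Finset.sum_add_distrib, Finset.sum_add_distrib, ← Finset.mul_sum,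
    ← Finset.card_filter, ← Finset.card_filter, ← Finset.card_filter, ← Finset.card_filter,
    Finset.sum_const, hcard, smul_eq_mul] at total
  omega

/-- The columns of odd multiplicity do not form the complement of a hyperplane. -/
theorem contradiction_of_affine (hF : IsWeightedSelfDual F) (hcol : GeneratedBy F col)
    (hI : Fintype.card I = 14) {l : Fin 4 → ZMod 2} (hl : l ≠ 0)
    (hodd : ∀ p, ((columnFiber col p).card : ZMod 2) = l ⬝ᵥ p)
    {v : (Fin 4 → ZMod 2) → Fin 6 → ZMod 2}
    (hv : ∀ p, (columnFiber col p).card = 2 → (fiberWord col p, v p) ∈ F)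
    {P Q : Fin 6 → ZMod 2} (hP : hammingNorm P = 4) (hQ : hammingNorm Q = 4) (hQP : Q ≠ P)
    (hPQ : P ⬝ᵥ Q = 0)
    (hval : ∀ p, (columnFiber col p).card = 2 → v p = P ∨ v p = Q ∨ v p = P + Q ∨ v p = 1) :
    False := by
  obtain ⟨i, j, -, ⟨hPi, hPj, -⟩, hQi, hQj, -⟩ := exists_coordinates P hP Q hQ hQP hPQ
  have single : ∀ p, l ⬝ᵥ p = 1 → (columnFiber col p).card = 1 := fun p hp => by
    have h2 := hF.card_columnFiber_le hcol p
    have h1 := hodd p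
    rw [hp] at h1
    interval_cases h : (columnFiber col p).card
    · exact absurd h1 (by decide)
    · rfl
    · exact absurd h1 (by decide)
  have double : ∀ p, l ⬝ᵥ p = 0 → (columnFiber col p).card ≠ 0 →
      (columnFiber col p).card = 2 := fun p hp hne => by
    have h2 := hF.card_columnFiber_le hcol p
    have h1 := hodd p
    rw [hp] at h1
    interval_cases h : (columnFiber col p).card
    · exact absurd rfl hne
    · exact absurd h1 (by decide)
    · rfl
  set D := Finset.univ.filter fun p => (columnFiber col p).card = 2 with hDdef
  have hD : ∀ p ∈ D, (columnFiber col p).card = 2 := fun p hp => (Finset.mem_filter.1 hp).2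
  have hcard : D.card = 3 := by
    have h : ∑ p, (columnFiber col p).card = 14 := by
      simp only [Finset.card_eq_sum_ones, sum_columnFiber]
      simp [hI]
    have e : ∀ p, (columnFiber col p).card =
        (if l ⬝ᵥ p = 1 then 1 else 0) + 2 * (if (columnFiber col p).card = 2 then 1 else 0) := by
      intro p
      rcases zmodTwo_eq_zero_or_one (l ⬝ᵥ p) with h0 | h0
      · by_cases hc : (columnFiber col p).card = 0
        · simp [h0, hc]
        · simp [h0, double p h0 hc]
      · simp [h0, single p h0]
    rw [Finset.sum_congr rfl fun p _ => e p, Finset.sum_add_distrib, ← Finset.mul_sum,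
      ← Finset.card_filter, ← Finset.card_filter, card_affine_hyperplane l hl] at h
    change 8 + 2 * D.card = 14 at h
    omega
  obtain ⟨p, q, r, hpq, hpr, hqr, he⟩ := Finset.card_eq_three.1 hcard
  have hp := hD p (by simp [he])
  have hq := hD q (by simp [he])
  have hr := hD r (by simp [he])
  -- the word `l ⬝ᵥ col i` is the indicator of the simple columns, so with the three pairs it adds
  -- up to the all-one word
  have hsum : v p + v q + v r = 1 := by
    have hmem : ((fun i => l ⬝ᵥ col i, 0) : (I → ZMod 2) × (Fin 6 → ZMod 2)) ∈ F :=
      (hcol _).2 ⟨l, fun _ => rfl⟩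
    have h := F.add_mem (F.add_mem (F.add_mem (F.add_mem (hv p hp) (hv q hq)) (hv r hr)) hmem)
      hF.one_mem
    have e : fiberWord col p + fiberWord col q + fiberWord col r + (fun i => l ⬝ᵥ col i) + 1 =
        0 := by
      ext i
      have hi : i ∈ columnFiber col (col i) := mem_columnFiber.2 rfl
      have hi0 : (columnFiber col (col i)).card ≠ 0 := (Finset.card_pos.2 ⟨i, hi⟩).ne'
      have hmemD : col i = p ∨ col i = q ∨ col i = r ↔ (columnFiber col (col i)).card = 2 := by
        have : col i ∈ D ↔ (columnFiber col (col i)).card = 2 := by simp [hDdef]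
        rw [← this, he]
        simp
      rcases zmodTwo_eq_zero_or_one (l ⬝ᵥ col i) with h0 | h0
      · rcases hmemD.2 (double _ h0 hi0) with h1 | h1 | h1 <;> rw [h1] at h0
        · simp only [Pi.add_apply, fiberWord, h1, h0]
          simp [hpq, hpr]; rfl
        · simp only [Pi.add_apply, fiberWord, h1, h0]
          simp [hpq.symm, hqr]; rfl
        · simp only [Pi.add_apply, fiberWord, h1, h0]
          simp [hpr.symm, hqr.symm]; rfl
      · have hn : ¬ (col i = p ∨ col i = q ∨ col i = r) := by
          rw [hmemD, single _ h0]; decide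
        push Not at hn
        simp [fiberWord, h0, hn]; rfl
    rw [Prod.mk_add_mk, Prod.mk_add_mk, Prod.mk_add_mk, Prod.mk_add_mk, e] at h
    have h0 := hF.snd_eq_zero h
    have h1 := add_self_zmodTwo (1 : Fin 6 → ZMod 2)
    linear_combination (exp := 1) h0 - h1
  -- if `v x = v y`, then `fiberWord col x + fiberWord col y` is generated by the four words alone
  have hne : ∀ x y, x ≠ y → (columnFiber col x).card = 2 → (columnFiber col y).card = 2 →
      v x ≠ v y := by
    intro x y hxy hx hy h
    have hmem := F.add_mem (hv x hx) (hv y hy)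
    rw [Prod.mk_add_mk, h, add_self_zmodTwo] at hmem
    obtain ⟨m, hm⟩ := (hcol _).1 hmem
    have hm0 : m = 0 := by
      refine eq_zero_of_vanish_affine l hl m fun s hs => ?_
      obtain ⟨i, hi⟩ := Finset.card_pos.1 ((single s hs).symm ▸ Nat.one_pos)
      rw [mem_columnFiber] at hi
      rw [← hi, ← hm i]
      have h1 : s ≠ x := fun h1 => by rw [← h1, single s hs] at hx; omega
      have h2 : s ≠ y := fun h2 => by rw [← h2, single s hs] at hy; omega
      simp [fiberWord, hi, h1, h2]
    obtain ⟨i, hi⟩ := Finset.card_pos.1 (hx.symm ▸ Nat.two_pos)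
    have := hm i
    rw [mem_columnFiber] at hi
    simp [fiberWord, hi, hxy, hm0] at this
  rcases eq_of_frame ⟨hPi, hPj⟩ ⟨hQi, hQj⟩ (hval p hp) (hval q hq) (hval r hr) hsum with h | h | h
  · exact hne p q hpq hp hq h
  · exact hne q r hqr hq hr h
  · exact hne p r hpr hp hr h

theorem false_of_card (hF : IsWeightedSelfDual F) (hI : Fintype.card I = 14) : False := by
  obtain ⟨col, hcol⟩ := hF.exists_generators hI
  obtain ⟨l, hl⟩ := hF.exists_odd_functional hcol hI
  obtain ⟨v, hv⟩ := hF.exists_pair_value hcol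
  obtain ⟨P, Q, ⟨hP, hQ, hQP, hPQ⟩, hval⟩ :=
    exists_frame (v '' {p | (columnFiber col p).card = 2}) (by
      rintro _ ⟨p, hp, rfl⟩
      exact (hv p hp).2) (by
      rintro _ ⟨p, hp, rfl⟩ _ ⟨q, hq, rfl⟩
      rw [← hF.dot_eq _ (hv p hp).1 _ (hv q hq).1, fiberWord_dotProduct]
      by_cases hpq : p = q
      · subst hpq
        rw [Finset.sum_congr rfl fun i hi => show fiberWord col p i = 1 by
          simp [fiberWord, mem_columnFiber.1 hi], Finset.sum_const, show _ = 2 from hp]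
        rfl
      · refine Finset.sum_eq_zero fun i hi => ?_
        simp [fiberWord, mem_columnFiber.1 hi, hpq])
  have hval' : ∀ p, (columnFiber col p).card = 2 → v p = P ∨ v p = Q ∨ v p = P + Q ∨ v p = 1 :=
    fun p hp => hval _ ⟨p, hp, rfl⟩
  by_cases hl0 : l = 0
  · exact hF.contradiction_of_doubled hcol hI (fun p => by rw [hl, hl0, zero_dotProduct])
      (fun p hp => (hv p hp).1) hP hQ hQP hPQ hval'
  · exact hF.contradiction_of_affine hcol hI hl0 hl (fun p hp => (hv p hp).1) hP hQ hQP hPQ hval'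

end IsWeightedSelfDual

/-! ### The contraction of a code along a permutation -/

namespace Equiv.Perm

variable {n m : ℕ} {σ : Equiv.Perm (Fin n)}

/-- The function on the coordinates that is constant on the cycles of `σ`, with values `A` on the
nontrivial cycles and `B` on the fixed points, the latter being numbered by `e`. -/
def expandFun {M : Type*} (e : {i // σ i = i} ≃ Fin m) (A : {g // g ∈ σ.cycleFactorsFinset} → M)
    (B : Fin m → M) (i : Fin n) : M :=
  if h : σ i = i then B (e ⟨i, h⟩)
  else A ⟨σ.cycleOf i, cycleOf_mem_cycleFactorsFinset_iff.2 (mem_support.2 h)⟩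

theorem card_support_of_cycleType {k p : ℕ} (hσ : σ.cycleType = Multiset.replicate k p)
    (g : {g // g ∈ σ.cycleFactorsFinset}) : g.1.support.card = p := by
  have h : g.1.support.card ∈ σ.cycleType := by
    rw [cycleType_def]
    exact Multiset.mem_map_of_mem _ g.2
  rw [hσ] at h
  exact Multiset.eq_of_mem_replicate h

theorem sum_expandFun {k p : ℕ} (hσ : σ.cycleType = Multiset.replicate k p) {M : Type*}
    [AddCommMonoid M] (e : {i // σ i = i} ≃ Fin m) (A : {g // g ∈ σ.cycleFactorsFinset} → M)
    (B : Fin m → M) : ∑ i, expandFun e A B i = ∑ j, B j + p • ∑ g, A g := by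
  rw [← Fintype.sum_subtype_add_sum_subtype (fun i => σ i = i)]
  congr 1
  · rw [← e.sum_comp]
    exact Finset.sum_congr rfl fun i _ => by simp [expandFun, i.2]
  · let c : {i // ¬ σ i = i} → {g // g ∈ σ.cycleFactorsFinset} := fun i =>
      ⟨σ.cycleOf i, cycleOf_mem_cycleFactorsFinset_iff.2 (mem_support.2 i.2)⟩
    have hc : ∀ i : {i // ¬ σ i = i}, expandFun e A B i = A (c i) := fun i => by
      simp [expandFun, i.2, c]
    rw [Finset.sum_congr rfl fun i _ => hc i, ← Finset.sum_fiberwise' Finset.univ c A,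
      Finset.smul_sum]
    refine Finset.sum_congr rfl fun g _ => ?_
    rw [Finset.sum_const]
    congr 1
    rw [← card_support_of_cycleType hσ g, ← Finset.card_map (Function.Embedding.subtype _)]
    congr 1
    ext i
    simp only [Finset.mem_map, Finset.mem_filter, Finset.mem_univ, true_and,
      Function.Embedding.coe_subtype]
    constructor
    · rintro ⟨i, hi, rfl⟩
      rw [← hi]
      exact mem_support_cycleOf_iff.2 ⟨SameCycle.refl _ _, mem_support.2 i.2⟩
    · intro hi
      have hs : σ i ≠ i := mem_support.1 (mem_cycleFactorsFinset_support_le g.2 hi)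
      exact ⟨⟨i, hs⟩, Subtype.ext (cycle_is_cycleOf hi g.2).symm, rfl⟩

theorem expandFun_apply_perm {M : Type*} (e : {i // σ i = i} ≃ Fin m)
    (A : {g // g ∈ σ.cycleFactorsFinset} → M) (B : Fin m → M) (i : Fin n) :
    expandFun e A B (σ i) = expandFun e A B i := by
  by_cases h : σ i = i
  · rw [h]
  · have h' : ¬ σ (σ i) = σ i := fun h' => h (σ.injective h')
    simp only [expandFun, h, h', dite_false]
    congr 2
    exact (SameCycle.refl σ i).apply_left.cycleOf_eq

/-- Every `σ`-invariant function is constant on the cycles of `σ`. -/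
theorem exists_expandFun {M : Type*} (e : {i // σ i = i} ≃ Fin m) {w : Fin n → M}
    (hw : ∀ i, w (σ i) = w i) : ∃ A B, expandFun e A B = w := by
  have hpow : ∀ (k : ℕ) (i : Fin n), w ((σ ^ k) i) = w i := fun k => by
    induction k with
    | zero => intro i; rfl
    | succ k ih => intro i; rw [pow_succ', mul_apply, hw, ih]
  have hne : ∀ g : {g // g ∈ σ.cycleFactorsFinset}, ∃ i, i ∈ g.1.support := fun g =>
    Finset.nonempty_iff_ne_empty.2 fun h =>
      (mem_cycleFactorsFinset_iff.1 g.2).1.ne_one (support_eq_empty_iff.1 h)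
  choose r hr using hne
  refine ⟨fun g => w (r g), fun j => w (e.symm j), funext fun i => ?_⟩
  by_cases h : σ i = i
  · simp [expandFun, h]
  · simp only [expandFun, h, dite_false]
    obtain ⟨k, -, -, hk⟩ := ((mem_support_cycleOf_iff.1
      (hr ⟨σ.cycleOf i, cycleOf_mem_cycleFactorsFinset_iff.2 (mem_support.2 h)⟩)).1).exists_pow_eq
    rw [← hk, hpow]

/-- `expandFun` for binary words: the linear map that sends `(a, b)` to the `σ`-invariant word with
value `a g` on the nontrivial cycle `g` and `b` on the fixed points. -/
def expand (e : {i // σ i = i} ≃ Fin m) :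
    (({g // g ∈ σ.cycleFactorsFinset} → ZMod 2) × (Fin m → ZMod 2)) →ₗ[ZMod 2]
      (Fin n → ZMod 2) where
  toFun x := expandFun e x.1 x.2
  map_add' x y := by ext i; by_cases h : σ i = i <;> simp [expandFun, h]
  map_smul' c x := by ext i; by_cases h : σ i = i <;> simp [expandFun, h]

theorem expand_apply (e : {i // σ i = i} ≃ Fin m) (x) : expand e x = expandFun e x.1 x.2 := rfl

/-- Each cycle contributes three equal terms, that is, one term modulo two. -/
theorem expand_dotProduct {k : ℕ} (hσ : σ.cycleType = Multiset.replicate k 3)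
    (e : {i // σ i = i} ≃ Fin m) (x y) :
    expand e x ⬝ᵥ expand e y = x.1 ⬝ᵥ y.1 + x.2 ⬝ᵥ y.2 := by
  have h := sum_expandFun hσ e (fun g => x.1 g * y.1 g) (fun j => x.2 j * y.2 j)
  have e1 : ∀ i, expandFun e (fun g => x.1 g * y.1 g) (fun j => x.2 j * y.2 j) i =
      expand e x i * expand e y i := fun i => by
    by_cases h : σ i = i <;> simp [expandFun, expand_apply, h]
  simp only [e1] at h
  rw [dotProduct, h, nsmul_eq_mul, show ((3 : ℕ) : ZMod 2) = 1 from rfl, one_mul, add_comm]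
  rfl

theorem hammingNorm_expand {k p : ℕ} (hσ : σ.cycleType = Multiset.replicate k p)
    (e : {i // σ i = i} ≃ Fin m) (x) :
    hammingNorm (expand e x) = p * hammingNorm x.1 + hammingNorm x.2 := by
  have h := sum_expandFun hσ e (fun g => if x.1 g ≠ 0 then 1 else 0)
    (fun j => if x.2 j ≠ 0 then 1 else 0)
  have e1 : ∀ i, expandFun e (fun g => if x.1 g ≠ 0 then 1 else 0)
      (fun j => if x.2 j ≠ 0 then 1 else 0) i = if expand e x i ≠ 0 then 1 else 0 := fun i => by
    by_cases h : σ i = i <;> simp [expandFun, expand_apply, h]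
  simp only [e1, ← Finset.card_filter, smul_eq_mul] at h
  rw [hammingNorm, hammingNorm, hammingNorm, h, add_comm]

end Equiv.Perm

open Equiv.Perm

/-- A `σ`-invariant word `x` that is orthogonal to the `σ`-invariant words of `C` is orthogonal to
all of `C`: for `c ∈ C` the word `c + σ c + σ² c` is invariant, and its product with `x` is
`3 (x ⬝ᵥ c) = x ⬝ᵥ c`. -/
theorem mem_of_orthogonal_fixed {n : ℕ} {σ : Equiv.Perm (Fin n)} (hσ : σ ^ 3 = 1)
    {C : Submodule (ZMod 2) (Fin n → ZMod 2)} (hC : IsSelfDualCode C)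
    (hσC : IsCodeAutomorphism σ C) {x : Fin n → ZMod 2} (hx : ∀ i, x (σ i) = x i)
    (horth : ∀ s ∈ C, (∀ i, s (σ i) = s i) → x ⬝ᵥ s = 0) : x ∈ C := by
  have hmem : ∀ c ∈ C, (fun i => c (σ.symm i)) ∈ C := fun c hc => by
    have h : (fun i => c (σ.symm i)) ∈
        (fun v : Fin n → ZMod 2 => fun i => v (σ.symm i)) '' (C : Set (Fin n → ZMod 2)) :=
      ⟨c, hc, rfl⟩
    rw [hσC] at h
    exact h
  have hdot : ∀ c : Fin n → ZMod 2, x ⬝ᵥ (fun i => c (σ.symm i)) = x ⬝ᵥ c := fun c => by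
    rw [dotProduct, ← Equiv.sum_comp σ]
    simp [hx, dotProduct]
  have hthree : ∀ i, σ i = σ.symm (σ.symm i) := fun i => by
    rw [Equiv.eq_symm_apply, Equiv.eq_symm_apply]
    have := congrArg (fun τ : Equiv.Perm (Fin n) => τ i) hσ
    simpa [pow_succ] using this
  rw [hC]
  intro c hc
  have h := horth _ (C.add_mem (C.add_mem hc (hmem c hc)) (hmem _ (hmem c hc))) fun i => by
    simp only [Pi.add_apply, Equiv.symm_apply_apply]
    rw [hthree i]
    ring
  rw [dotProduct_add, dotProduct_add, hdot fun i => c (σ.symm i), hdot, add_self_zmodTwo,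
    zero_add] at h
  exact h

/-- The contraction of the subcode of `σ`-invariant words. -/
theorem isWeightedSelfDual_comap_expand {n k : ℕ} {σ : Equiv.Perm (Fin n)}
    (hσ : σ.cycleType = Multiset.replicate k 3) {C : Submodule (ZMod 2) (Fin n → ZMod 2)}
    (hC : IsSelfDualCode C) (hd : HasMinDistance C 10) (hσC : IsCodeAutomorphism σ C)
    (e : {i // σ i = i} ≃ Fin 6) : IsWeightedSelfDual (C.comap (expand e)) where
  dot_eq x hx y hy := by
    have h : expand e x ∈ dualCode C := hC ▸ hx
    have h0 := h _ hy
    rw [expand_dotProduct hσ] at h0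
    have := add_self_zmodTwo (x.2 ⬝ᵥ y.2)
    linear_combination h0 - this
  mem_of_dot_eq x hx := by
    have hord : σ ^ 3 = 1 := by
      rw [← orderOf_dvd_iff_pow_eq_one, ← lcm_cycleType, Multiset.lcm_dvd]
      intro b hb
      rw [hσ] at hb
      rw [Multiset.eq_of_mem_replicate hb]
    refine mem_of_orthogonal_fixed hord hC hσC (expandFun_apply_perm e x.1 x.2) fun s hs hfix => ?_
    obtain ⟨A, B, rfl⟩ := exists_expandFun e hfix
    change expand e x ⬝ᵥ expand e (A, B) = 0
    rw [expand_dotProduct hσ, hx (A, B) hs]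
    exact add_self_zmodTwo _
  weight x hx hne := by
    rw [← hammingNorm_expand hσ e]
    have h0 : expand e x ≠ 0 := fun h0 => by
      have h := hammingNorm_expand hσ e x
      rw [h0, hammingNorm_zero] at h
      exact hne (Prod.ext (hammingNorm_eq_zero.1 (by omega)) (hammingNorm_eq_zero.1 (by omega)))
    exact hd.2 ⟨_, hx, 0, C.zero_mem, h0, hammingDist_zero_right _⟩

theorem mainTheorem4 :
    ¬ ∃ C : Submodule (ZMod 2) (Fin 48 → ZMod 2),
      IsSelfDualCode C ∧ IsBinaryCode 48 24 10 C ∧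
        ∃ σ : Equiv.Perm (Fin 48), IsCodeAutomorphism σ C ∧ HasCycleStructure σ 3 14 6 := by
  rintro ⟨C, hC, ⟨-, hd⟩, σ, hσC, hσ, hfix⟩
  have e : {i // σ i = i} ≃ Fin 6 :=
    Fintype.equivFinOfCardEq (by rw [Fintype.card_subtype, hfix])
  refine (isWeightedSelfDual_comap_expand hσ hC hd hσC e).false_of_card ?_
  rw [Fintype.card_coe, ← Multiset.card_replicate 14 3, ← hσ, cycleType_def, Multiset.card_map]
  rfl
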